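/- Let $d,N\ge 1$ and let $\mathcal O\subset\mathbb R^d$ be a bounded open set with $C^2$ boundary and outer unit normal $\nu$ (that is, near each boundary point $\mathcal O=\{\rho<0\}$ for some $C^2$ function $\rho$ with $\nabla\rho\ne0$ at that point, and there $\nu=\nabla\rho/|\nabla\rho|$). Let $b_1,\dots,b_N\in C^2(\overline{\mathcal O};\mathbb R^d)$ satisfy, for all $1\le i\le N$: (i) $\langle b_i,\nu\rangle=0$ on $\partial\mathcal O$; (ii) $\sum_{k=1}^d b_i^k\,\partial_k b_l^j=\sum_{k=1}^d b_l^k\,\partial_k b_i^j$ on $\overline{\mathcal O}$ for all $1\le j\le d$ and all $1\le l\le N$ with $l\neq i$; (iii) $\operatorname{div} b_i=0$ and $\langle\Delta b_i,b_i\rangle=0$ on $\overline{\mathcal O}$ ($\Delta$ acting componentwise); (iv) $\sum_{j,k=1}^d(\partial_k b_i^j+\partial_j b_i^k)\,\nu_k\,b_i^j=0$ on $\partial\mathcal O$. For each $i$ consider the unbounded operator $B_iu=\langle b_i,\nabla u\rangle$ in the real Hilbert space $L^2(\mathcal O)$ with domain $H^1(\mathcal O)$ ($\nabla u$ being the weak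 gradient). Then $B_i$ is densely defined, and, with $B_i^*$ its adjoint in $L^2(\mathcal O)$: 1. $B_i$ is skew-adjoint on $H^1(\mathcal O)$ in the sense that every $u\in H^1(\mathcal O)$ belongs to the domain of $B_i^*$ and $$B_iu=-B_i^*u\qquad\text{for all }u\in H^1(\mathcal O).$$ 2. For all $u\in H^1(\mathcal O)$, the function $u\,B_iu$ is integrable on $\mathcal O$ and $\displaystyle\int_{\mathcal O}u\,B_iu\,d\xi=0$. -/

import Mathlib

open MeasureTheory Set Filter Topology
open scoped ENNReal ContDiff InnerProductSpace

/-- The Euclidean space `ℝ^d`. -/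
abbrev Rd (d : ℕ) : Type := EuclideanSpace ℝ (Fin d)

/-! ### Domains with smooth boundary and the outer unit normal -/

/-- `ρ` is a `C²` local defining function of `O` at `x`: near `x`, the set `O` is `{ρ < 0}`, and
`∇ρ(x) ≠ 0`. (`ContDiffAt ℝ 2` means that `ρ` is `C²` in a neighbourhood of `x`.) -/
structure IsLocalDefiningFunction {d : ℕ} (O : Set (Rd d)) (x : Rd d) (ρ : Rd d → ℝ) : Prop where
  contDiffAt : ContDiffAt ℝ 2 ρ x
  gradient_ne_zero : gradient ρ x ≠ 0
  mem_iff : ∀ᶠ y in 𝓝 x, y ∈ O ↔ ρ y < 0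

/-- `O` has a `C²` boundary (and lies locally on one side of it). -/
def HasC2Boundary {d : ℕ} (O : Set (Rd d)) : Prop :=
  ∀ x ∈ frontier O, ∃ ρ : Rd d → ℝ, IsLocalDefiningFunction O x ρ

/-- `ν` is the outer unit normal of `O` at the boundary point `x`, that is `∇ρ(x) / |∇ρ(x)|` for a
local defining function `ρ`. -/
def IsOuterUnitNormal {d : ℕ} (O : Set (Rd d)) (x ν : Rd d) : Prop :=
  ∃ ρ : Rd d → ℝ, IsLocalDefiningFunction O x ρ ∧ ν = ‖gradient ρ x‖⁻¹ • gradient ρ x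

/-! ### The assumption on the coefficient fields -/

/-- The Jacobian on the closure of `O` (one-sided at the boundary). -/
noncomputable def jacobian {d : ℕ} (O : Set (Rd d)) (b : Rd d → Rd d) (x : Rd d) :
    Rd d →L[ℝ] Rd d :=
  fderivWithin ℝ b (closure O) x

/-- The divergence `∑ₖ ∂ₖ bᵏ` on the closure of `O`. -/
noncomputable def divergence {d : ℕ} (O : Set (Rd d)) (b : Rd d → Rd d) (x : Rd d) : ℝ :=
  ∑ k : Fin d, jacobian O b x (EuclideanSpace.single k 1) k

/-- The standing assumption on the coefficient fields `b₁, …, b_N ∈ C²(closure O; ℝ^d)`. The values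
of the functions `b i` outside `closure O` play no role. -/
structure CoefficientAssumption {d N : ℕ} (O : Set (Rd d)) (b : Fin N → Rd d → Rd d) : Prop where
  contDiffOn : ∀ i, ContDiffOn ℝ 2 (b i) (closure O)
  /-- `⟨bᵢ, ν⟩ = 0` on the boundary. -/
  tangential : ∀ i, ∀ x ∈ frontier O, ∀ ν, IsOuterUnitNormal O x ν → ⟪b i x, ν⟫_ℝ = 0
  /-- `∑ₖ bᵢᵏ ∂ₖ bₗ = ∑ₖ bₗᵏ ∂ₖ bᵢ` on the closure, for `i ≠ l`. -/
  commute : ∀ i l, i ≠ l → ∀ x ∈ closure O,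
    jacobian O (b l) x (b i x) = jacobian O (b i) x (b l x)
  /-- `div bᵢ = 0` on the closure. -/
  div_eq_zero : ∀ i, ∀ x ∈ closure O, divergence O (b i) x = 0
  /-- `⟨Δ bᵢ, bᵢ⟩ = 0` on the closure. -/
  laplacian_orthogonal : ∀ i, ∀ x ∈ closure O,
    ⟪InnerProductSpace.laplacianWithin (b i) (closure O) x, b i x⟫_ℝ = 0
  /-- `⟨⟨∇bᵢ, ν⟩, bᵢ⟩ + ⟨⟨∇bᵢ, bᵢ⟩, ν⟩ = 0` on the boundary. -/
  boundary_killing : ∀ i, ∀ x ∈ frontier O, ∀ ν, IsOuterUnitNormal O x ν →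
    ⟪jacobian O (b i) x ν, b i x⟫_ℝ + ⟪jacobian O (b i) x (b i x), ν⟫_ℝ = 0

/-! ### `L²`, weak gradients and `H¹` -/

/-- The real Hilbert space `L²(O)` with respect to Lebesgue measure. -/
abbrev L2 {d : ℕ} (O : Set (Rd d)) : Type := Lp ℝ 2 (volume.restrict O)

/-- The space `L²(O; ℝ^d)`. -/
abbrev L2Vec {d : ℕ} (O : Set (Rd d)) : Type := Lp (Rd d) 2 (volume.restrict O)

/-- `g` is the weak gradient of `u` in `O`: `∫ u ∂ⱼφ = - ∫ gⱼ φ` for all `φ ∈ C_c^∞(O)` and all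
`j`. -/
def IsWeakGradient {d : ℕ} (O : Set (Rd d)) (u : L2 O) (g : L2Vec O) : Prop :=
  ∀ φ : Rd d → ℝ, ContDiff ℝ ∞ φ → HasCompactSupport φ → tsupport φ ⊆ O → ∀ j : Fin d,
    ∫ x in O, u x * fderiv ℝ φ x (EuclideanSpace.single j 1) = - ∫ x in O, g x j * φ x

theorem memLp_coord {d : ℕ} {O : Set (Rd d)} (g : L2Vec O) (j : Fin d) :
    MemLp (fun x => g x j) 2 (volume.restrict O) :=
  (EuclideanSpace.proj (𝕜 := ℝ) j).comp_memLp' (Lp.memLp g)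

theorem integrable_mul_testFunction {d : ℕ} {O : Set (Rd d)} {f φ : Rd d → ℝ}
    (hf : MemLp f 2 (volume.restrict O)) (hφ : Continuous φ) (hc : HasCompactSupport φ) :
    Integrable (fun x => f x * φ x) (volume.restrict O) :=
  MemLp.integrable_mul (p := 2) (q := 2) hf (hφ.memLp_of_hasCompactSupport hc)

theorem integrable_mul_partial {d : ℕ} {O : Set (Rd d)} {f φ : Rd d → ℝ}
    (hf : MemLp f 2 (volume.restrict O)) (hφ : ContDiff ℝ ∞ φ) (hc : HasCompactSupport φ)
    (v : Rd d) : Integrable (fun x => f x * fderiv ℝ φ x v) (volume.restrict O) :=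
  integrable_mul_testFunction hf ((hφ.continuous_fderiv (by simp)).clm_apply continuous_const)
    (hc.fderiv_apply (𝕜 := ℝ) v)

theorem IsWeakGradient.add {d : ℕ} {O : Set (Rd d)} {u v : L2 O} {g h : L2Vec O}
    (hu : IsWeakGradient O u g) (hv : IsWeakGradient O v h) :
    IsWeakGradient O (u + v) (g + h) := by
  intro φ hφ hc hs j
  have e1 : ∫ x in O, (u + v : L2 O) x * fderiv ℝ φ x (EuclideanSpace.single j 1) =
      ∫ x in O, (u x * fderiv ℝ φ x (EuclideanSpace.single j 1) +
        v x * fderiv ℝ φ x (EuclideanSpace.single j 1)) := by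
    refine integral_congr_ae ?_
    filter_upwards [Lp.coeFn_add u v] with x hx
    rw [hx, Pi.add_apply, add_mul]
  have e2 : ∫ x in O, (g + h : L2Vec O) x j * φ x = ∫ x in O, (g x j * φ x + h x j * φ x) := by
    refine integral_congr_ae ?_
    filter_upwards [Lp.coeFn_add g h] with x hx
    rw [hx, Pi.add_apply, PiLp.add_apply, add_mul]
  rw [e1, e2, integral_add (integrable_mul_partial (Lp.memLp u) hφ hc _)
    (integrable_mul_partial (Lp.memLp v) hφ hc _),
    integral_add (integrable_mul_testFunction (memLp_coord g j) hφ.continuous hc)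
    (integrable_mul_testFunction (memLp_coord h j) hφ.continuous hc),
    hu φ hφ hc hs j, hv φ hφ hc hs j]
  ring

theorem IsWeakGradient.smul {d : ℕ} {O : Set (Rd d)} {u : L2 O} {g : L2Vec O} (c : ℝ)
    (hu : IsWeakGradient O u g) : IsWeakGradient O (c • u) (c • g) := by
  intro φ hφ hc hs j
  have e1 : ∫ x in O, (c • u : L2 O) x * fderiv ℝ φ x (EuclideanSpace.single j 1) =
      ∫ x in O, c * (u x * fderiv ℝ φ x (EuclideanSpace.single j 1)) := by
    refine integral_congr_ae ?_
    filter_upwards [Lp.coeFn_smul c u] with x hx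
    rw [hx, Pi.smul_apply, smul_eq_mul, mul_assoc]
  have e2 : ∫ x in O, (c • g : L2Vec O) x j * φ x = ∫ x in O, c * (g x j * φ x) := by
    refine integral_congr_ae ?_
    filter_upwards [Lp.coeFn_smul c g] with x hx
    rw [hx, Pi.smul_apply, PiLp.smul_apply, smul_eq_mul, mul_assoc]
  rw [e1, e2, integral_const_mul, integral_const_mul, hu φ hφ hc hs j, mul_neg]

theorem IsWeakGradient.zero {d : ℕ} (O : Set (Rd d)) : IsWeakGradient O 0 0 := by
  intro φ hφ hc hs j
  have e1 : ∫ x in O, (0 : L2 O) x * fderiv ℝ φ x (EuclideanSpace.single j 1) = 0 := by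
    refine integral_eq_zero_of_ae ?_
    filter_upwards [Lp.coeFn_zero ℝ 2 (volume.restrict O)] with x hx
    rw [hx]; simp
  have e2 : ∫ x in O, (0 : L2Vec O) x j * φ x = 0 := by
    refine integral_eq_zero_of_ae ?_
    filter_upwards [Lp.coeFn_zero (Rd d) 2 (volume.restrict O)] with x hx
    rw [hx]; simp
  rw [e1, e2, neg_zero]

/-- On an open set the weak gradient is unique. -/
theorem IsWeakGradient.unique {d : ℕ} {O : Set (Rd d)} (hO : IsOpen O) {u : L2 O} {g h : L2Vec O}
    (hg : IsWeakGradient O u g) (hh : IsWeakGradient O u h) : g = h := by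
  have key : ∀ j : Fin d, ∀ᵐ x ∂(volume.restrict O), g x j = h x j := by
    intro j
    have hloc : LocallyIntegrableOn (fun x => g x j - h x j) O volume :=
      locallyIntegrableOn_of_locallyIntegrable_restrict
        (((memLp_coord g j).sub (memLp_coord h j)).locallyIntegrable (by norm_num))
    have hz := hO.ae_eq_zero_of_integral_contDiff_smul_eq_zero hloc (by
      intro φ hφ hc hs
      have hsub : ∫ x in O, (g x j * φ x - h x j * φ x) = 0 := by
        rw [integral_sub (integrable_mul_testFunction (memLp_coord g j) hφ.continuous hc)
          (integrable_mul_testFunction (memLp_coord h j) hφ.continuous hc)]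
        have := hg φ hφ hc hs j
        have := hh φ hφ hc hs j
        linarith
      rw [← hsub, ← setIntegral_eq_integral_of_forall_compl_eq_zero (s := O)]
      · refine integral_congr_ae (Eventually.of_forall fun x => ?_)
        simp only [smul_eq_mul]
        ring
      · intro x hx
        rw [image_eq_zero_of_notMem_tsupport (fun hx' => hx (hs hx')), zero_smul])
    rw [ae_restrict_iff' hO.measurableSet]
    filter_upwards [hz] with x hx hxO
    exact sub_eq_zero.mp (hx hxO)
  refine Lp.ext ?_
  filter_upwards [ae_all_iff.mpr key] with x hx
  ext j
  exact hx j

/-- The Sobolev space `H¹(O) = W^{1,2}(O)`, as a linear subspace of `L²(O)`. -/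
def H1 {d : ℕ} (O : Set (Rd d)) : Submodule ℝ (L2 O) where
  carrier := {u | ∃ g : L2Vec O, IsWeakGradient O u g}
  add_mem' := by
    rintro u v ⟨g, hg⟩ ⟨h, hh⟩
    exact ⟨g + h, hg.add hh⟩
  zero_mem' := ⟨0, IsWeakGradient.zero O⟩
  smul_mem' := by
    rintro c u ⟨g, hg⟩
    exact ⟨c • g, hg.smul c⟩

/-- The weak gradient `∇u ∈ L²(O; ℝ^d)` of `u ∈ H¹(O)`. -/
noncomputable def weakGradient {d : ℕ} {O : Set (Rd d)} (u : H1 O) : L2Vec O :=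
  Classical.choose u.2

theorem isWeakGradient_weakGradient {d : ℕ} {O : Set (Rd d)} (u : H1 O) :
    IsWeakGradient O u (weakGradient u) :=
  Classical.choose_spec u.2

/-! ### The first-order operator -/

/-- For `b` continuous on the compact set `closure O`, multiplication by `b` maps `L²(O; ℝ^d)` to
`L²(O)`. -/
theorem memLp_inner_field {d : ℕ} {O : Set (Rd d)} (hO : IsOpen O) (hbd : Bornology.IsBounded O)
    {b : Rd d → Rd d} (hb : ContinuousOn b (closure O)) (g : L2Vec O) :
    MemLp (fun x => ⟪b x, g x⟫_ℝ) 2 (volume.restrict O) := by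
  obtain ⟨C, hC⟩ := hbd.isCompact_closure.exists_bound_of_continuousOn hb
  have hmeas : AEStronglyMeasurable b (volume.restrict O) :=
    (hb.mono subset_closure).aestronglyMeasurable hO.measurableSet
  refine (Lp.memLp g).of_le_mul (c := C) (hmeas.inner (Lp.memLp g).1) ?_
  filter_upwards [ae_restrict_mem hO.measurableSet] with x hx
  exact (norm_inner_le_norm _ _).trans
    (mul_le_mul_of_nonneg_right (hC x (subset_closure hx)) (norm_nonneg _))

/-- The unbounded operator `B u = ⟨b, ∇u⟩` in `L²(O)` with domain `H¹(O)`. -/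
noncomputable def fieldOperator {d : ℕ} {O : Set (Rd d)} (hO : IsOpen O)
    (hbd : Bornology.IsBounded O) {b : Rd d → Rd d} (hb : ContinuousOn b (closure O)) :
    L2 O →ₗ.[ℝ] L2 O where
  domain := H1 O
  toFun :=
    { toFun := fun u => (memLp_inner_field hO hbd hb (weakGradient u)).toLp
        (fun x => ⟪b x, weakGradient u x⟫_ℝ)
      map_add' := by
        intro u v
        have e : weakGradient (u + v) = weakGradient u + weakGradient v :=
          (isWeakGradient_weakGradient (u + v)).unique hO
            ((isWeakGradient_weakGradient u).add (isWeakGradient_weakGradient v))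
        rw [← MemLp.toLp_add]
        refine MemLp.toLp_congr _ _ ?_
        filter_upwards [Lp.coeFn_add (weakGradient u) (weakGradient v)] with x hx
        rw [e, hx, Pi.add_apply, inner_add_right, Pi.add_apply]
      map_smul' := by
        intro c u
        have e : weakGradient (c • u) = c • weakGradient u :=
          (isWeakGradient_weakGradient (c • u)).unique hO
            ((isWeakGradient_weakGradient u).smul c)
        rw [RingHom.id_apply, ← MemLp.toLp_const_smul]
        refine MemLp.toLp_congr _ _ ?_
        filter_upwards [Lp.coeFn_smul c (weakGradient u)] with x hx
        rw [e, hx, Pi.smul_apply, inner_smul_right, Pi.smul_apply, smul_eq_mul] }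

theorem fieldOperator_coeFn {d : ℕ} {O : Set (Rd d)} (hO : IsOpen O)
    (hbd : Bornology.IsBounded O) {b : Rd d → Rd d} (hb : ContinuousOn b (closure O)) (u : H1 O) :
    ⇑(fieldOperator hO hbd hb u) =ᵐ[volume.restrict O] fun x => ⟪b x, weakGradient u x⟫_ℝ :=
  MemLp.coeFn_toLp (memLp_inner_field hO hbd hb (weakGradient u))

/-! For a divergence-free field `b`, `u ⟨b, ∇v⟩ + v ⟨b, ∇u⟩` is the divergence of `u v b`, so its
integral over `O` should be a boundary flux, which vanishes because `b` is tangential. This is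
skew-symmetry of the operator on `H1 O`; density of the domain then turns it into `B u = -B* u`, and
the choice `v = u` gives the second claim.

The proof avoids traces and smooth approximation up to the boundary. For a `C¹` cutoff `χ` compactly
supported in `O`, a Leibniz rule for two Sobolev functions gives `∫ χ (u ⟨b, ∇v⟩ + v ⟨b, ∇u⟩) + u v
⟨b, ∇χ⟩ = 0` (`IsWeakGradient.integral_cutoff_field`). It remains to let `χ` tend to `1`. The
gradient of `χ` blows up near the boundary, but its component along `b` need not: tangentiality and
the regularity of `b` and `ρ` give `|⟨b, ∇ρ⟩| ≤ K |ρ|` (`exists_abs_fderiv_le`), so cutoffs that are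
functions of `n ρ` have `⟨b, ∇χ⟩` bounded uniformly in `n` (`hasTangentialCutoffs_frontier`). Since
`u v` is integrable, dominated convergence removes the last term
(`IsWeakGradient.integral_field_skew`). -/

/-! ### Mollification and weak convergence in `L²`. -/

section Mollification

open scoped Convolution

variable {d : ℕ}

/-- This is the `L²` pairing of `u` with a translate of `f`, and translation acts continuously on
`Lp` for finite exponents. -/
theorem continuous_integral_mul_translate {u f : Rd d → ℝ} (hu : MemLp u 2 volume)
    (hf : MemLp f 2 volume) : Continuous fun s : Rd d => ∫ x, u x * f (s + x) := by
  have : Fact ((2 : ℝ≥0∞) ≠ ⊤) := ⟨by simp⟩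
  have h : (fun s : Rd d => ∫ x, u x * f (s + x)) =
      fun s => ⟪hu.toLp u, DomAddAct.mk s +ᵥ hf.toLp f⟫_ℝ := by
    funext s
    rw [L2.inner_def]
    refine integral_congr_ae ?_
    have h1 := DomAddAct.vadd_Lp_ae_eq (DomAddAct.mk s) (hf.toLp f)
    have h2 : (fun x => (hf.toLp f) (s + x)) =ᵐ[volume] fun x => f (s + x) :=
      (measurePreserving_add_left volume s).quasiMeasurePreserving.ae_eq_comp hf.coeFn_toLp
    filter_upwards [h1, h2, hu.coeFn_toLp] with x h1 h2 h3
    rw [h1, h3]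
    simp only [DomAddAct.mk, vadd_eq_add] at *
    change _ = ⟪_, (hf.toLp f) (s + x)⟫_ℝ
    rw [h2]
    simp [mul_comm]
  rw [h]
  refine Continuous.inner continuous_const ?_
  have h2 : Continuous fun s : Rd d => (DomAddAct.mk s : (Rd d)ᵈᵃᵃ) := DomAddAct.continuous_mk
  exact h2.vadd continuous_const

/-- Justifies Fubini below. Bounding `|u f|` by `u² + f²` leaves a tensor product and a convolution
integrand of `L¹` functions. -/
theorem integrable_mul_mul_sub {u f η : Rd d → ℝ} (hu : MemLp u 2 volume)
    (hf : MemLp f 2 volume) (hη : Continuous η) (hc : HasCompactSupport η) :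
    Integrable (fun p : Rd d × Rd d => u p.1 * (η p.2 * f (p.1 - p.2)))
      (volume.prod volume) := by
  have hη' : Integrable η volume := hη.integrable_of_hasCompactSupport hc
  have h1 : Integrable (fun p : Rd d × Rd d => u p.1 ^ 2 * ‖η p.2‖) (volume.prod volume) :=
    hu.integrable_sq.mul_prod hη'.norm
  have h2 : Integrable (fun p : Rd d × Rd d => ‖η p.2‖ * f (p.1 - p.2) ^ 2)
      (volume.prod volume) :=
    Integrable.convolution_integrand (ContinuousLinearMap.mul ℝ ℝ) hη'.norm hf.integrable_sq
  have hm : AEStronglyMeasurable (fun p : Rd d × Rd d => f (p.1 - p.2))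
      (volume.prod volume) :=
    hf.1.comp_quasiMeasurePreserving (quasiMeasurePreserving_sub volume volume)
  refine (h1.add h2).mono' (hu.1.comp_fst.mul
    ((hη.comp continuous_snd).aestronglyMeasurable.mul hm)) (Eventually.of_forall fun p => ?_)
  have e : ‖u p.1 * (η p.2 * f (p.1 - p.2))‖ = ‖η p.2‖ * (|u p.1| * |f (p.1 - p.2)|) := by
    rw [norm_mul, norm_mul, Real.norm_eq_abs, Real.norm_eq_abs, Real.norm_eq_abs]; ring
  rw [e, Pi.add_apply, mul_comm (u p.1 ^ 2), ← mul_add]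
  refine mul_le_mul_of_nonneg_left ?_ (norm_nonneg _)
  rw [← sq_abs (u p.1), ← sq_abs (f _)]
  nlinarith [sq_nonneg (|u p.1| - |f (p.1 - p.2)|), sq_nonneg (|u p.1| + |f (p.1 - p.2)|)]

/-- Mollifications of an `L²` function converge weakly in `L²`. -/
theorem tendsto_integral_mul_normed_convolution {u f : Rd d → ℝ} (hu : MemLp u 2 volume)
    (hf : MemLp f 2 volume) {φ : ℕ → ContDiffBump (0 : Rd d)}
    (hφ : Tendsto (fun n => (φ n).rOut) atTop (𝓝 0)) :
    Tendsto (fun n => ∫ x, u x * ((φ n).normed volume ⋆[ContinuousLinearMap.lsmul ℝ ℝ] f) x)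
      atTop (𝓝 (∫ x, u x * f x)) := by
  -- By Fubini, the pairing of `u` with the mollified `f` is the mollification, evaluated at `0`, of
  -- the continuous function `s ↦ ∫ u(x) f(s + x)`.
  have h := ContDiffBump.convolution_tendsto_right_of_continuous (μ := volume) hφ
    (continuous_integral_mul_translate hu hf) 0
  simp only [zero_add] at h
  refine h.congr fun n => ?_
  have hc := (φ n).continuous_normed (μ := volume)
  have hs := (φ n).hasCompactSupport_normed (μ := volume)
  have e : ∀ x, u x * ((φ n).normed volume ⋆[ContinuousLinearMap.lsmul ℝ ℝ] f) x =
      ∫ t, u x * ((φ n).normed volume t * f (x - t)) := by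
    intro x
    rw [integral_const_mul]
    rfl
  simp_rw [e]
  rw [integral_integral_swap (integrable_mul_mul_sub hu hf hc hs), convolution_def]
  refine integral_congr_ae (Eventually.of_forall fun t => ?_)
  simp only [ContinuousLinearMap.lsmul_apply, smul_eq_mul]
  rw [← integral_const_mul]
  refine integral_congr_ae (Eventually.of_forall fun x => ?_)
  simp only [zero_sub, ← sub_eq_neg_add]
  ring

/-- Mollification commutes with weak differentiation. -/
theorem fderiv_normed_convolution_eq {w w' : Rd d → ℝ} {v : Rd d}
    (hw : LocallyIntegrable w volume)
    (h : ∀ φ : Rd d → ℝ, ContDiff ℝ ∞ φ → HasCompactSupport φ →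
      ∫ x, w x * fderiv ℝ φ x v = -∫ x, w' x * φ x) (η : ContDiffBump (0 : Rd d)) (x : Rd d) :
    fderiv ℝ (η.normed volume ⋆[ContinuousLinearMap.lsmul ℝ ℝ] w) x v =
      (η.normed volume ⋆[ContinuousLinearMap.lsmul ℝ ℝ] w') x := by
  have hη : ContDiff ℝ ∞ (η.normed volume) := η.contDiff_normed
  have hc := η.hasCompactSupport_normed (μ := volume)
  have hη1 : ContDiff ℝ 1 (η.normed volume) := hη.of_le (by simp)
  have hex : ConvolutionExistsAt (fderiv ℝ (η.normed volume)) w x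
      ((ContinuousLinearMap.lsmul ℝ ℝ).precompL (Rd d)) volume :=
    (hc.fderiv ℝ).convolutionExists_left _ (hη1.continuous_fderiv one_ne_zero) hw x
  rw [(hc.hasFDerivAt_convolution_left (ContinuousLinearMap.lsmul ℝ ℝ) hη1 hw x).fderiv,
    convolution_def, ContinuousLinearMap.integral_apply hex, convolution_eq_swap]
  have hcomp : ContDiff ℝ ∞ fun t => η.normed volume (x - t) :=
    hη.comp (contDiff_const.sub contDiff_id)
  have hsupp : HasCompactSupport fun t => η.normed volume (x - t) :=
    hc.comp_homeomorph (Homeomorph.subLeft x)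
  -- The test function is `t ↦ η(x - t)`; the sign from its inner derivative cancels the one from
  -- integration by parts.
  have key := h _ hcomp hsupp
  have hder : ∀ t, fderiv ℝ (fun t => η.normed volume (x - t)) t v =
      -fderiv ℝ (η.normed volume) (x - t) v := by
    intro t
    have h1 : HasFDerivAt (η.normed volume) (fderiv ℝ (η.normed volume) (x - t)) (x - t) :=
      (hη1.differentiable one_ne_zero _).hasFDerivAt
    have h2 : HasFDerivAt (fun t => x - t) (-ContinuousLinearMap.id ℝ (Rd d)) t :=
      (hasFDerivAt_id t).const_sub x
    have := (h1.comp t h2).fderiv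
    rw [Function.comp_def] at this
    rw [this]
    simp
  simp_rw [hder, mul_neg, integral_neg, neg_inj] at key
  have e1 : ∫ t, ((ContinuousLinearMap.lsmul ℝ ℝ).precompL (Rd d)
      (fderiv ℝ (η.normed volume) t) (w (x - t))) v =
      ∫ t, w t * fderiv ℝ (η.normed volume) (x - t) v := by
    rw [← integral_sub_left_eq_self (fun t => w t * fderiv ℝ (η.normed volume) (x - t) v)
      volume x]
    refine integral_congr_ae (Eventually.of_forall fun t => ?_)
    simp [ContinuousLinearMap.precompL_apply, mul_comm]
  rw [e1, key]
  refine integral_congr_ae (Eventually.of_forall fun t => ?_)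
  simp [mul_comm]

end Mollification

/-! ### Leibniz rule and Green's formula away from the boundary. -/

section ProductRule

open scoped Convolution

variable {d : ℕ} {O : Set (Rd d)}

theorem exists_contDiffBump_rOut_tendsto_zero (d : ℕ) : ∃ φ : ℕ → ContDiffBump (0 : Rd d),
    Tendsto (fun n => (φ n).rOut) atTop (𝓝 0) := by
  refine ⟨fun n => ⟨1 / ((n : ℝ) + 1) / 2, 1 / ((n : ℝ) + 1), by positivity,
    half_lt_self (by positivity)⟩, ?_⟩
  exact tendsto_one_div_add_atTop_nhds_zero_nat

theorem setIntegral_mul_eq_integral_indicator (hO : MeasurableSet O) (u f : Rd d → ℝ) :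
    ∫ x in O, u x * f x = ∫ x, O.indicator u x * f x := by
  rw [← integral_indicator hO]
  refine integral_congr_ae (Eventually.of_forall fun x => ?_)
  simp only [indicator]
  split_ifs <;> simp

theorem tendsto_setIntegral_mul_normed_convolution (hO : MeasurableSet O) {u f : Rd d → ℝ}
    (hu : MemLp u 2 (volume.restrict O)) (hf : MemLp f 2 volume)
    {φ : ℕ → ContDiffBump (0 : Rd d)} (hφ : Tendsto (fun n => (φ n).rOut) atTop (𝓝 0)) :
    Tendsto
      (fun n => ∫ x in O, u x * ((φ n).normed volume ⋆[ContinuousLinearMap.lsmul ℝ ℝ] f) x)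
      atTop (𝓝 (∫ x in O, u x * f x)) := by
  simp_rw [setIntegral_mul_eq_integral_indicator hO]
  exact tendsto_integral_mul_normed_convolution ((memLp_indicator_iff_restrict hO).2 hu) hf hφ

theorem tsupport_normed_convolution_subset {w : Rd d → ℝ} {K : Set (Rd d)}
    (hw : Function.support w ⊆ K) (φ : ContDiffBump (0 : Rd d)) :
    tsupport (φ.normed volume ⋆[ContinuousLinearMap.lsmul ℝ ℝ] w) ⊆
      Metric.cthickening φ.rOut K := by
  refine closure_minimal ?_ Metric.isClosed_cthickening
  refine (support_convolution_subset_swap _).trans ?_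
  rw [φ.support_normed_eq]
  rintro x ⟨a, ha, b, hb, rfl⟩
  refine Metric.mem_cthickening_of_dist_le _ a _ _ (hw ha) ?_
  have : ‖b‖ < φ.rOut := by simpa using hb
  simpa [dist_eq_norm] using this.le

/-- A weak gradient may be tested against compactly supported `L²` functions with an `L²` weak
partial derivative. -/
theorem IsWeakGradient.integral_mul_eq_of_weak (hO : IsOpen O) {u : L2 O} {g : L2Vec O}
    (hu : IsWeakGradient O u g) (j : Fin d) {w w' : Rd d → ℝ} (hw : MemLp w 2 volume)
    (hw' : MemLp w' 2 volume) {K : Set (Rd d)} (hK : IsCompact K) (hKO : K ⊆ O)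
    (hsupp : Function.support w ⊆ K)
    (h : ∀ φ : Rd d → ℝ, ContDiff ℝ ∞ φ → HasCompactSupport φ →
      ∫ x, w x * fderiv ℝ φ x (EuclideanSpace.single j 1) = -∫ x, w' x * φ x) :
    ∫ x in O, u x * w' x = -∫ x in O, g x j * w x := by
  obtain ⟨φ, hφ⟩ := exists_contDiffBump_rOut_tendsto_zero d
  -- Once `rOut < δ`, the mollified `w` is an admissible test function. Only pairings with the fixed
  -- functions `u` and `g j` pass to the limit, so weak convergence suffices.
  obtain ⟨δ, hδ, hδO⟩ := hK.exists_cthickening_subset_open hO hKO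
  have h1 := tendsto_setIntegral_mul_normed_convolution hO.measurableSet (Lp.memLp u) hw' hφ
  have h2 := (tendsto_setIntegral_mul_normed_convolution hO.measurableSet (memLp_coord g j) hw
    hφ).neg
  refine tendsto_nhds_unique (h1.congr' ?_) h2
  have hloc : LocallyIntegrable w volume := hw.locallyIntegrable (by norm_num)
  filter_upwards [hφ.eventually (gt_mem_nhds hδ)] with n hn
  have hsub := tsupport_normed_convolution_subset hsupp (φ n)
  have hcd : ContDiff ℝ ∞ ((φ n).normed volume ⋆[ContinuousLinearMap.lsmul ℝ ℝ] w) :=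
    ((φ n).hasCompactSupport_normed (μ := volume)).contDiff_convolution_left _
      (φ n).contDiff_normed hloc
  have := hu _ hcd
    (hK.cthickening.of_isClosed_subset (isClosed_tsupport _) hsub)
    (hsub.trans ((Metric.cthickening_mono hn.le K).trans hδO)) j
  simp_rw [fderiv_normed_convolution_eq hloc h (φ n)] at this
  exact this

theorem memLp_of_contDiff_one {ψ : Rd d → ℝ} (hψ : ContDiff ℝ 1 ψ) (hc : HasCompactSupport ψ) :
    MemLp ψ 2 volume :=
  hψ.continuous.memLp_of_hasCompactSupport hc

/-- A weak gradient may be tested against `C¹` functions. -/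
theorem IsWeakGradient.integral_mul_fderiv (hO : IsOpen O) {u : L2 O} {g : L2Vec O}
    (hu : IsWeakGradient O u g) {ψ : Rd d → ℝ} (hψ : ContDiff ℝ 1 ψ) (hc : HasCompactSupport ψ)
    (hs : tsupport ψ ⊆ O) (j : Fin d) :
    ∫ x in O, u x * fderiv ℝ ψ x (EuclideanSpace.single j 1) = -∫ x in O, g x j * ψ x := by
  have hψ' : Continuous fun x => fderiv ℝ ψ x (EuclideanSpace.single j 1) :=
    (hψ.continuous_fderiv one_ne_zero).clm_apply continuous_const
  have hc' : HasCompactSupport fun x => fderiv ℝ ψ x (EuclideanSpace.single j 1) :=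
    hc.fderiv_apply (𝕜 := ℝ) _
  refine hu.integral_mul_eq_of_weak hO j (memLp_of_contDiff_one hψ hc)
    (hψ'.memLp_of_hasCompactSupport hc') hc hs (subset_tsupport ψ) fun φ hφ hcφ => ?_
  have hφ' : Continuous fun x => fderiv ℝ φ x (EuclideanSpace.single j 1) :=
    (hφ.continuous_fderiv (by simp)).clm_apply continuous_const
  refine integral_mul_fderiv_eq_neg_fderiv_mul_of_integrable ?_ ?_ ?_
    (fun x _ => hψ.differentiable one_ne_zero x) (fun x _ => hφ.differentiable (by simp) x)
  · exact (hψ'.mul hφ.continuous).integrable_of_hasCompactSupport hc'.mul_right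
  · exact (hψ.continuous.mul hφ').integrable_of_hasCompactSupport hc.mul_right
  · exact (hψ.continuous.mul hφ.continuous).integrable_of_hasCompactSupport hc.mul_right

theorem memLp_mul_indicator (hO : MeasurableSet O) {f ψ : Rd d → ℝ}
    (hf : MemLp f 2 (volume.restrict O)) (hψ : Continuous ψ) (hc : HasCompactSupport ψ) :
    MemLp (fun x => ψ x * O.indicator f x) 2 volume := by
  obtain ⟨C, hC⟩ := hc.exists_bound_of_continuous hψ
  have hf' := (memLp_indicator_iff_restrict hO).2 hf
  refine hf'.of_le_mul (c := C) (hψ.aestronglyMeasurable.mul hf'.1)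
    (Eventually.of_forall fun x => ?_)
  rw [norm_mul]
  exact mul_le_mul_of_nonneg_right (hC x) (norm_nonneg _)

/-- The Leibniz rule for the product of two `H¹` functions, tested against a `C¹` function. -/
theorem IsWeakGradient.integral_mul_mul_fderiv (hO : IsOpen O) {u v : L2 O} {g h : L2Vec O}
    (hu : IsWeakGradient O u g) (hv : IsWeakGradient O v h) {ψ : Rd d → ℝ}
    (hψ : ContDiff ℝ 1 ψ) (hc : HasCompactSupport ψ) (hs : tsupport ψ ⊆ O) (j : Fin d) :
    ∫ x in O, u x * (ψ x * h x j + fderiv ℝ ψ x (EuclideanSpace.single j 1) * v x) =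
      -∫ x in O, g x j * (ψ x * v x) := by
  have hψ' : Continuous fun x => fderiv ℝ ψ x (EuclideanSpace.single j 1) :=
    (hψ.continuous_fderiv one_ne_zero).clm_apply continuous_const
  have hc' : HasCompactSupport fun x => fderiv ℝ ψ x (EuclideanSpace.single j 1) :=
    hc.fderiv_apply (𝕜 := ℝ) _
  have hm := hO.measurableSet
  -- Here `w = ψ v`, extended by zero because the representative of `v` is arbitrary off `O`. That
  -- `w'` is its weak derivative follows by testing the weak gradient of `v` against `ψ φ`.
  have key := hu.integral_mul_eq_of_weak hO j
    (w := fun x => ψ x * O.indicator v x)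
    (w' := fun x => ψ x * O.indicator (fun x => h x j) x +
      fderiv ℝ ψ x (EuclideanSpace.single j 1) * O.indicator v x)
    (memLp_mul_indicator hm (Lp.memLp v) hψ.continuous hc)
    ((memLp_mul_indicator hm (memLp_coord h j) hψ.continuous hc).add
      (memLp_mul_indicator hm (Lp.memLp v) hψ' hc'))
    hc hs ?_ ?_
  · have e1 : ∀ x ∈ O, u x * (ψ x * h x j + fderiv ℝ ψ x (EuclideanSpace.single j 1) * v x) =
        u x * (ψ x * O.indicator (fun x => h x j) x +
          fderiv ℝ ψ x (EuclideanSpace.single j 1) * O.indicator v x) := by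
      intro x hx
      rw [indicator_of_mem hx, indicator_of_mem hx]
    have e2 : ∀ x ∈ O, g x j * (ψ x * v x) = g x j * (ψ x * O.indicator v x) := by
      intro x hx
      rw [indicator_of_mem hx]
    rw [setIntegral_congr_fun hm e1, setIntegral_congr_fun hm e2]
    exact key
  · intro x hx
    exact subset_tsupport ψ (left_ne_zero_of_mul hx)
  · intro φ hφ hcφ
    have hφ1 : ContDiff ℝ 1 φ := hφ.of_le (by simp)
    have hsφ : tsupport (fun x => ψ x * φ x) ⊆ O :=
      (tsupport_mul_subset_left (f := ψ) (g := φ)).trans hs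
    have hcφ' : HasCompactSupport fun x => ψ x * φ x := hc.mul_right
    have h1 := hv.integral_mul_fderiv hO (hψ.mul hφ1) hcφ' hsφ j
    have hd : ∀ x, fderiv ℝ (fun x => ψ x * φ x) x (EuclideanSpace.single j 1) =
        ψ x * fderiv ℝ φ x (EuclideanSpace.single j 1) +
          φ x * fderiv ℝ ψ x (EuclideanSpace.single j 1) := by
      intro x
      rw [fderiv_fun_mul (hψ.differentiable one_ne_zero x) (hφ1.differentiable one_ne_zero x)]
      simp
    have hφ' : Continuous fun x => fderiv ℝ φ x (EuclideanSpace.single j 1) :=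
      (hφ1.continuous_fderiv one_ne_zero).clm_apply continuous_const
    have i1 : Integrable (fun x => v x * (ψ x * fderiv ℝ φ x (EuclideanSpace.single j 1)))
        (volume.restrict O) :=
      integrable_mul_testFunction (Lp.memLp v) (hψ.continuous.mul hφ') hc.mul_right
    have i2 : Integrable (fun x => v x * (φ x * fderiv ℝ ψ x (EuclideanSpace.single j 1)))
        (volume.restrict O) :=
      integrable_mul_testFunction (Lp.memLp v) (hφ1.continuous.mul hψ') hcφ.mul_right
    have i3 : Integrable (fun x => h x j * (ψ x * φ x)) (volume.restrict O) :=
      integrable_mul_testFunction (memLp_coord h j) (hψ.continuous.mul hφ1.continuous)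
        hc.mul_right
    simp_rw [hd, mul_add] at h1
    rw [integral_add i1 i2] at h1
    have e1 : ∫ x, ψ x * O.indicator v x * fderiv ℝ φ x (EuclideanSpace.single j 1) =
        ∫ x in O, v x * (ψ x * fderiv ℝ φ x (EuclideanSpace.single j 1)) := by
      rw [setIntegral_mul_eq_integral_indicator hm]
      exact integral_congr_ae (Eventually.of_forall fun x => by simp only; ring)
    have e2 : ∫ x, (ψ x * O.indicator (fun x => h x j) x +
          fderiv ℝ ψ x (EuclideanSpace.single j 1) * O.indicator v x) * φ x =
        ∫ x in O, (h x j * (ψ x * φ x) +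
          v x * (φ x * fderiv ℝ ψ x (EuclideanSpace.single j 1))) := by
      rw [← integral_indicator hm]
      refine integral_congr_ae (Eventually.of_forall fun x => ?_)
      by_cases hx : x ∈ O
      · simp only [indicator_of_mem hx]; ring
      · simp only [indicator_of_notMem hx]; ring
    rw [e1, e2, integral_add i3 i2]
    linarith

/-- Green's formula for a divergence-free field and a `C¹` cutoff function. -/
theorem IsWeakGradient.integral_cutoff_field (hO : IsOpen O) {u v : L2 O} {g h : L2Vec O}
    (hu : IsWeakGradient O u g) (hv : IsWeakGradient O v h) {b : Rd d → Rd d}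
    (hb : ContDiffOn ℝ 1 b O)
    (hdiv : ∀ x ∈ O, ∑ k : Fin d, fderiv ℝ b x (EuclideanSpace.single k 1) k = 0)
    {χ : Rd d → ℝ} (hχ : ContDiff ℝ 1 χ) (hc : HasCompactSupport χ) (hs : tsupport χ ⊆ O) :
    ∫ x in O, (χ x * (u x * ⟪b x, h x⟫_ℝ + v x * ⟪b x, g x⟫_ℝ) +
      u x * v x * fderiv ℝ χ x (b x)) = 0 := by
  have hbj : ∀ j, ContDiffOn ℝ 1 (fun x => b x j) O := fun j =>
    (EuclideanSpace.proj (𝕜 := ℝ) j).contDiff.comp_contDiffOn hb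
  -- The field is regular only on `O`, but `χ` vanishes near every point outside its support, which
  -- lies in `O`.
  have hψ : ∀ j, ContDiff ℝ 1 fun x => χ x * b x j := by
    intro j
    rw [contDiff_iff_contDiffAt]
    intro x
    by_cases hx : x ∈ tsupport χ
    · exact hχ.contDiffAt.mul ((hbj j).contDiffAt (hO.mem_nhds (hs hx)))
    · have : (fun x => χ x * b x j) =ᶠ[𝓝 x] fun _ => 0 := by
        filter_upwards [notMem_tsupport_iff_eventuallyEq.1 hx] with y hy
        rw [hy]; simp
      exact contDiffAt_const.congr_of_eventuallyEq this
  have hψc : ∀ j, HasCompactSupport fun x => χ x * b x j := fun j => hc.mul_right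
  have hψs : ∀ j, tsupport (fun x => χ x * b x j) ⊆ O := fun j =>
    (tsupport_mul_subset_left (f := χ) (g := fun x => b x j)).trans hs
  have hcont : ∀ j, Continuous fun x =>
      fderiv ℝ (fun x => χ x * b x j) x (EuclideanSpace.single j 1) := fun j =>
    ((hψ j).continuous_fderiv one_ne_zero).clm_apply continuous_const
  have hcs : ∀ j, HasCompactSupport fun x =>
      fderiv ℝ (fun x => χ x * b x j) x (EuclideanSpace.single j 1) := fun j =>
    (hψc j).fderiv_apply (𝕜 := ℝ) _
  have i0 : ∀ (a : L2 O) (f ψ : Rd d → ℝ), MemLp f 2 (volume.restrict O) → Continuous ψ →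
      HasCompactSupport ψ → Integrable (fun x => a x * (ψ x * f x)) (volume.restrict O) := by
    intro a f ψ hf hψ hψc
    have h1 := (memLp_mul_indicator hO.measurableSet hf hψ hψc).restrict O
    have h2 : Integrable (fun x => a x * (ψ x * O.indicator f x)) (volume.restrict O) :=
      MemLp.integrable_mul (p := 2) (q := 2) (Lp.memLp a) h1
    refine h2.congr ?_
    filter_upwards [ae_restrict_mem hO.measurableSet] with x hx
    rw [indicator_of_mem hx]
  have i1 : ∀ j, Integrable (fun x => u x * (χ x * b x j * h x j +
      fderiv ℝ (fun x => χ x * b x j) x (EuclideanSpace.single j 1) * v x))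
      (volume.restrict O) := by
    intro j
    refine ((i0 u _ _ (memLp_coord h j) (hψ j).continuous (hψc j)).add
      (i0 u _ _ (Lp.memLp v) (hcont j) (hcs j))).congr (Eventually.of_forall fun x => ?_)
    simp only [Pi.add_apply]; ring
  have i2 : ∀ j, Integrable (fun x => g x j * (χ x * b x j * v x)) (volume.restrict O) := by
    intro j
    refine (i0 v _ _ (memLp_coord g j) (hψ j).continuous (hψc j)).congr
      (Eventually.of_forall fun x => ?_)
    simp only; ring
  have hj : ∀ j, ∫ x in O, (u x * (χ x * b x j * h x j +
      fderiv ℝ (fun x => χ x * b x j) x (EuclideanSpace.single j 1) * v x) +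
      g x j * (χ x * b x j * v x)) = 0 := by
    intro j
    rw [integral_add (i1 j) (i2 j),
      hu.integral_mul_mul_fderiv hO hv (hψ j) (hψc j) (hψs j) j]
    ring
  have hsum : ∫ x in O, ∑ j, (u x * (χ x * b x j * h x j +
      fderiv ℝ (fun x => χ x * b x j) x (EuclideanSpace.single j 1) * v x) +
      g x j * (χ x * b x j * v x)) = 0 := by
    rw [integral_finsetSum]
    · exact Finset.sum_eq_zero fun j _ => hj j
    · exact fun j _ => (i1 j).add (i2 j)
  rw [← hsum]
  refine setIntegral_congr_fun hO.measurableSet fun x hx => ?_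
  have hbx : DifferentiableAt ℝ b x := (hb.contDiffAt (hO.mem_nhds hx)).differentiableAt
    one_ne_zero
  have hd : ∀ j, fderiv ℝ (fun x => χ x * b x j) x (EuclideanSpace.single j 1) =
      χ x * fderiv ℝ b x (EuclideanSpace.single j 1) j +
        b x j * fderiv ℝ χ x (EuclideanSpace.single j 1) := by
    intro j
    have h1 : HasFDerivAt (fun x => b x j)
        ((EuclideanSpace.proj (𝕜 := ℝ) j).comp (fderiv ℝ b x)) x :=
      (EuclideanSpace.proj (𝕜 := ℝ) j).hasFDerivAt.comp x hbx.hasFDerivAt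
    rw [((hχ.differentiable one_ne_zero x).hasFDerivAt.fun_mul h1).fderiv]
    simp
  have hχb : fderiv ℝ χ x (b x) = ∑ j, b x j * fderiv ℝ χ x (EuclideanSpace.single j 1) := by
    conv_lhs => rw [← (EuclideanSpace.basisFun (Fin d) ℝ).sum_repr (b x)]
    simp
  have hin : ∀ y : Rd d, ⟪b x, y⟫_ℝ = ∑ j, b x j * y j := by
    intro y
    simp [PiLp.inner_apply, mul_comm]
  simp only [hd]
  rw [hχb, hin, hin]
  -- Expanding `∂ⱼ(χ bⱼ)` and summing produces `u v χ div b`, the only term absent from the target.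
  have hz : ∑ j, u x * v x * (χ x * fderiv ℝ b x (EuclideanSpace.single j 1) j) = 0 := by
    rw [← Finset.mul_sum, ← Finset.mul_sum, hdiv x hx]; simp
  rw [← add_zero (χ x * _ + _), ← hz]
  simp only [Finset.mul_sum, ← Finset.sum_add_distrib]
  refine Finset.sum_congr rfl fun j _ => ?_
  ring

end ProductRule

/-! ### Linear decay of `⟨b, ∇ρ⟩` at the boundary. -/

section TangentialBound

variable {d : ℕ} {O : Set (Rd d)}

theorem IsLocalDefiningFunction.eq_zero_of_mem_frontier (hO : IsOpen O) {y : Rd d}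
    (hy : y ∈ frontier O) {ρ : Rd d → ℝ} (hρ : IsLocalDefiningFunction O y ρ) : ρ y = 0 := by
  have hc : ContinuousAt ρ y := hρ.contDiffAt.continuousAt
  have hyO : y ∉ O := by
    rw [hO.frontier_eq] at hy
    exact hy.2
  refine le_antisymm ?_ (not_lt.1 fun h => hyO (hρ.mem_iff.self_of_nhds.2 h))
  by_contra! hpos
  have h1 := hc.eventually (lt_mem_nhds hpos)
  obtain ⟨z, ⟨hz, hz'⟩, hzO⟩ := mem_closure_iff_nhds.1 (frontier_subset_closure hy) _
    (h1.and hρ.mem_iff)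
  exact lt_asymm hz (hz'.1 hzO)

/-- All three conditions are open, so a single `ρ` describes the normal at every nearby boundary
point, where tangentiality can then be used. -/
theorem IsLocalDefiningFunction.eventually {x : Rd d} {ρ : Rd d → ℝ}
    (hρ : IsLocalDefiningFunction O x ρ) : ∀ᶠ y in 𝓝 x, IsLocalDefiningFunction O y ρ := by
  have h1 : ContinuousAt (fun y => fderiv ℝ ρ y) x :=
    (hρ.contDiffAt.fderiv_right (m := 1) (by norm_num)).continuousAt
  have h0 : fderiv ℝ ρ x ≠ 0 := by
    have := hρ.gradient_ne_zero
    simpa [gradient] using this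
  filter_upwards [hρ.contDiffAt.eventually (by simp), hρ.mem_iff.eventually_nhds,
    h1.eventually_ne h0] with y hy1 hy2 hy3
  refine ⟨hy1, ?_, hy2⟩
  simpa [gradient] using hy3

theorem IsLocalDefiningFunction.fderiv_apply_eq_zero {y : Rd d} {ρ : Rd d → ℝ}
    (hρ : IsLocalDefiningFunction O y ρ) {v : Rd d}
    (hv : ∀ ν, IsOuterUnitNormal O y ν → ⟪v, ν⟫_ℝ = 0) : fderiv ℝ ρ y v = 0 := by
  have h := hv _ ⟨ρ, hρ, rfl⟩
  rw [inner_smul_right, mul_eq_zero] at h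
  have h2 := h.resolve_left (inv_ne_zero (norm_ne_zero_iff.2 hρ.gradient_ne_zero))
  rwa [real_inner_comm, gradient, InnerProductSpace.toDual_symm_apply] at h2

/-- The derivative bounds make `F + 2 L ρ` and `-F + 2 L ρ` nondecreasing, and both vanish at `T`.
-/
theorem abs_le_two_mul_abs_of_deriv_bound {ρ F ρ' F' : ℝ → ℝ} {T L : ℝ} (hT : 0 ≤ T)
    (hρ : ContinuousOn ρ (Icc 0 T)) (hF : ContinuousOn F (Icc 0 T))
    (hρ' : ∀ t ∈ Ioo 0 T, HasDerivAt ρ (ρ' t) t) (hF' : ∀ t ∈ Ioo 0 T, HasDerivAt F (F' t) t)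
    (hρb : ∀ t ∈ Ioo 0 T, 1 / 2 ≤ ρ' t) (hFb : ∀ t ∈ Ioo 0 T, |F' t| ≤ L)
    (hL : 0 ≤ L) (hρT : ρ T = 0) (hFT : F T = 0) : |F 0| ≤ 2 * L * |ρ 0| := by
  have h0 : (0 : ℝ) ∈ Icc 0 T := ⟨le_rfl, hT⟩
  have hTT : T ∈ Icc 0 T := ⟨hT, le_rfl⟩
  have m1 : MonotoneOn (fun t => F t + 2 * L * ρ t) (Icc 0 T) := by
    refine monotoneOn_of_hasDerivWithinAt_nonneg (f' := fun t => F' t + 2 * L * ρ' t)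
      (convex_Icc 0 T) (hF.add (continuousOn_const.mul hρ)) ?_ ?_
    · intro t ht
      rw [interior_Icc] at ht
      exact ((hF' t ht).add ((hρ' t ht).const_mul _)).hasDerivWithinAt
    · intro t ht
      rw [interior_Icc] at ht
      have := (abs_le.1 (hFb t ht)).1
      nlinarith [mul_le_mul_of_nonneg_left (hρb t ht) hL]
  have m2 : MonotoneOn (fun t => -F t + 2 * L * ρ t) (Icc 0 T) := by
    refine monotoneOn_of_hasDerivWithinAt_nonneg (f' := fun t => -F' t + 2 * L * ρ' t)
      (convex_Icc 0 T) (hF.neg.add (continuousOn_const.mul hρ)) ?_ ?_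
    · intro t ht
      rw [interior_Icc] at ht
      exact ((hF' t ht).neg.add ((hρ' t ht).const_mul _)).hasDerivWithinAt
    · intro t ht
      rw [interior_Icc] at ht
      have := (abs_le.1 (hFb t ht)).2
      nlinarith [mul_le_mul_of_nonneg_left (hρb t ht) hL]
  have a1 := m1 h0 hTT hT
  have a2 := m2 h0 hTT hT
  simp only [hρT, hFT] at a1 a2
  have := mul_le_mul_of_nonneg_left (neg_le_abs (ρ 0)) (by linarith : 0 ≤ 2 * L)
  rw [abs_le]
  constructor <;> nlinarith

/-- The derivative along `e` is `D²ρ(e, b) + Dρ(Db e)`. It extends continuously to `x₀` within the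
closure, because the one-sided derivative `D` of `b` does; `L` is the absolute value at `x₀` plus
one. -/
theorem exists_deriv_bound_field {b : Rd d → Rd d} {x₀ e : Rd d} {ρ : Rd d → ℝ}
    (hO : IsOpen O) (hb : ContDiffWithinAt ℝ 2 b (closure O) x₀) (hx₀ : x₀ ∈ closure O)
    (hρ : ContDiffAt ℝ 2 ρ x₀) :
    ∃ L, 0 ≤ L ∧ ∀ᶠ y in 𝓝 x₀, y ∈ O → ∃ F' : Rd d →L[ℝ] ℝ,
      HasFDerivAt (fun y => fderiv ℝ ρ y (b y)) F' y ∧ |F' e| ≤ L := by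
  have hb' : ContDiffWithinAt ℝ (1 + 1) b (closure O) x₀ := by
    rw [one_add_one_eq_two]; exact hb
  obtain ⟨s, hs, -, -, D, hD, hDc⟩ :=
    (contDiffWithinAt_succ_iff_hasFDerivWithinAt' (by simp)).1 hb'
  rw [insert_eq_of_mem hx₀] at hs
  have hA : ContDiffAt ℝ 1 (fun y => fderiv ℝ ρ y) x₀ := hρ.fderiv_right (by norm_num)
  have hAA : ContinuousAt (fun y => fderiv ℝ (fderiv ℝ ρ) y) x₀ :=
    (hA.fderiv_right (m := 0) (by norm_num)).continuousAt
  have hcont : ContinuousWithinAt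
      (fun y => |fderiv ℝ (fderiv ℝ ρ) y e (b y) + fderiv ℝ ρ y (D y e)|) (closure O) x₀ := by
    refine ContinuousWithinAt.abs (ContinuousWithinAt.add ?_ ?_)
    · exact (hAA.continuousWithinAt.clm_apply continuousWithinAt_const).clm_apply
        hb.continuousWithinAt
    · exact hA.continuousAt.continuousWithinAt.clm_apply
        (hDc.continuousWithinAt.clm_apply continuousWithinAt_const)
  set L := |fderiv ℝ (fderiv ℝ ρ) x₀ e (b x₀) + fderiv ℝ ρ x₀ (D x₀ e)| + 1
  refine ⟨L, by positivity, ?_⟩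
  have h1 := hcont.eventually (gt_mem_nhds (lt_add_one _))
  rw [eventually_nhdsWithin_iff] at h1
  have h2 : ∀ᶠ y in 𝓝 x₀, y ∈ closure O → y ∈ s := eventually_nhdsWithin_iff.1 hs
  filter_upwards [h1, h2, hA.eventually (by simp)] with y h1 h2 h3 hy
  have hyc := subset_closure hy
  have hDy : HasFDerivAt b (D y) y :=
    (hD y (h2 hyc)).hasFDerivAt (mem_of_superset (hO.mem_nhds hy) subset_closure)
  have hAy := (h3.differentiableAt one_ne_zero).hasFDerivAt
  refine ⟨_, hAy.clm_apply hDy, ?_⟩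
  have := (h1 hyc).le
  rw [add_comm] at this
  exact this

/-- If `b` is tangential to the boundary, then `⟨b, ∇ρ⟩` is controlled by `|ρ|`. -/
theorem exists_abs_fderiv_le (hO : IsOpen O) {b : Rd d → Rd d}
    (hb : ContDiffOn ℝ 2 b (closure O))
    (htan : ∀ x ∈ frontier O, ∀ ν, IsOuterUnitNormal O x ν → ⟪b x, ν⟫_ℝ = 0)
    {x₀ : Rd d} (hx₀ : x₀ ∈ frontier O) {ρ : Rd d → ℝ}
    (hρ : IsLocalDefiningFunction O x₀ ρ) :
    ∃ K, 0 ≤ K ∧ ∀ᶠ x in 𝓝 x₀, x ∈ O → |fderiv ℝ ρ x (b x)| ≤ K * |ρ x| := by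
  -- A direction transverse to the boundary: near `x₀`, `ρ` grows along `e` at rate at least `1 /
  -- 2`.
  obtain ⟨e, he⟩ : ∃ e, fderiv ℝ ρ x₀ e = 1 := by
    have h0 : fderiv ℝ ρ x₀ ≠ 0 := by
      have := hρ.gradient_ne_zero
      simpa [gradient] using this
    obtain ⟨v, hv⟩ : ∃ v, fderiv ℝ ρ x₀ v ≠ 0 := by
      by_contra! h
      exact h0 (ContinuousLinearMap.ext h)
    exact ⟨(fderiv ℝ ρ x₀ v)⁻¹ • v, by simp [hv]⟩
  have hx₀c := frontier_subset_closure hx₀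
  obtain ⟨L, hL, hLe⟩ := exists_deriv_bound_field (e := e) hO (hb x₀ hx₀c) hx₀c hρ.contDiffAt
  have hA : ContinuousAt (fun y => fderiv ℝ ρ y e) x₀ :=
    (hρ.contDiffAt.fderiv_right (m := 1) (by norm_num)).continuousAt.clm_apply
      continuousAt_const
  have hAe : ∀ᶠ y in 𝓝 x₀, 1 / 2 < fderiv ℝ ρ y e :=
    hA.eventually (lt_mem_nhds (by simp only [he]; norm_num))
  obtain ⟨r, hr, hball⟩ := Metric.eventually_nhds_iff_ball.1
    ((hρ.eventually.and hLe).and hAe)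
  have hρ0 : ρ x₀ = 0 := hρ.eq_zero_of_mem_frontier hO hx₀
  -- Segments of duration `τ` starting in the ball of radius `r / 2` stay in the ball of radius `r`.
  obtain ⟨τ, hτ, hτr⟩ : ∃ τ > 0, τ * ‖e‖ < r / 2 := by
    refine ⟨r / 2 / (‖e‖ + 1), by positivity, ?_⟩
    rw [div_mul_eq_mul_div, div_lt_iff₀ (by positivity)]
    nlinarith [norm_nonneg e]
  -- At growth rate `1 / 2`, this ensures that `ρ` reaches `0` along `e` before time `τ`.
  have hρsmall : ∀ᶠ x in 𝓝 x₀, -(τ / 2) < ρ x :=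
    hρ.contDiffAt.continuousAt.eventually (lt_mem_nhds (by rw [hρ0]; linarith))
  refine ⟨2 * L, by positivity, ?_⟩
  filter_upwards [hρsmall, Metric.ball_mem_nhds x₀ (half_pos hr)] with x hxρ hxb hxO
  have hin : ∀ t ∈ Icc 0 τ, x + t • e ∈ Metric.ball x₀ r := by
    intro t ht
    rw [Metric.mem_ball, dist_eq_norm] at hxb ⊢
    calc ‖x + t • e - x₀‖ = ‖(x - x₀) + t • e‖ := by congr 1; abel
      _ ≤ ‖x - x₀‖ + ‖t • e‖ := norm_add_le _ _
      _ < r / 2 + r / 2 := by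
        refine add_lt_add hxb ?_
        rw [norm_smul, Real.norm_of_nonneg ht.1]
        exact (mul_le_mul_of_nonneg_right ht.2 (norm_nonneg _)).trans_lt hτr
      _ = r := by ring
  have hline : ∀ t : ℝ, HasDerivAt (fun t : ℝ => x + t • e) e t := fun t => by
    simpa using ((hasDerivAt_id t).smul_const e).const_add x
  have hρline : ∀ t ∈ Icc 0 τ,
      HasDerivAt (fun t : ℝ => ρ (x + t • e)) (fderiv ℝ ρ (x + t • e) e) t := fun t ht =>
    ((hball _ (hin t ht)).1.1.contDiffAt.differentiableAt
      two_ne_zero).hasFDerivAt.comp_hasDerivAt t (hline t)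
  have hρcont : ContinuousOn (fun t : ℝ => ρ (x + t • e)) (Icc 0 τ) := fun t ht =>
    (hρline t ht).continuousAt.continuousWithinAt
  have hmono : StrictMonoOn (fun t : ℝ => ρ (x + t • e)) (Icc 0 τ) := by
    refine strictMonoOn_of_hasDerivWithinAt_pos (convex_Icc 0 τ) hρcont
      (f' := fun t => fderiv ℝ ρ (x + t • e) e) ?_ ?_
    · intro t ht
      exact (hρline t (interior_subset ht)).hasDerivWithinAt
    · intro t ht
      have := (hball _ (hin t (interior_subset ht))).2
      linarith
  have hmem : ∀ t ∈ Icc 0 τ, x + t • e ∈ O ↔ ρ (x + t • e) < 0 := fun t ht =>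
    (hball _ (hin t ht)).1.1.mem_iff.self_of_nhds
  have h0 : (0 : ℝ) ∈ Icc 0 τ := ⟨le_rfl, hτ.le⟩
  have hneg : ρ x < 0 := by simpa using (hmem 0 h0).1 (by simpa using hxO)
  have hpos : 0 ≤ ρ (x + τ • e) := by
    have := (convex_Icc 0 τ).mul_sub_le_image_sub_of_le_deriv (C := 1 / 2) hρcont
      (fun t ht => (hρline t (interior_subset ht)).differentiableAt.differentiableWithinAt)
      (fun t ht => by
        rw [(hρline t (interior_subset ht)).deriv]
        exact (hball _ (hin t (interior_subset ht))).2.le) 0 h0 τ ⟨hτ.le, le_rfl⟩ hτ.le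
    simp at this
    linarith
  -- The time at which the ray leaves `O`. Strict monotonicity keeps it in `O` before `T`, so `x + T
  -- • e` is a boundary point and `⟨b, ∇ρ⟩` vanishes there.
  obtain ⟨T, hT, hTz⟩ : (0 : ℝ) ∈ (fun t : ℝ => ρ (x + t • e)) '' Icc 0 τ :=
    intermediate_value_Icc hτ.le hρcont ⟨by simpa using hneg.le, hpos⟩
  simp only at hTz
  have hT0 : 0 < T := by
    refine lt_of_le_of_ne hT.1 fun h => ?_
    rw [← h] at hTz
    simp at hTz
    exact hneg.ne hTz
  have hsub : Icc 0 T ⊆ Icc 0 τ := Icc_subset_Icc_right hT.2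
  have hltO : ∀ t ∈ Ico 0 T, x + t • e ∈ O := by
    intro t ht
    have ht' : t ∈ Icc 0 τ := hsub ⟨ht.1, ht.2.le⟩
    rw [hmem t ht', ← hTz]
    exact hmono ht' hT ht.2
  have hcl : ∀ t ∈ Icc 0 T, x + t • e ∈ closure O := by
    intro t ht
    have hc : Continuous fun t : ℝ => x + t • e := by fun_prop
    have : t ∈ closure (Ico 0 T) := by rwa [closure_Ico hT0.ne]
    exact (MapsTo.closure (s := Ico 0 T) (t := O) hltO hc) this
  have hTf : x + T • e ∈ frontier O := by
    rw [hO.frontier_eq]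
    exact ⟨hcl T ⟨hT0.le, le_rfl⟩, fun h => ((hmem T hT).1 h).ne hTz⟩
  have hFcont : ContinuousOn (fun t : ℝ => fderiv ℝ ρ (x + t • e) (b (x + t • e)))
      (Icc 0 T) := by
    have hc : Continuous fun t : ℝ => x + t • e := by fun_prop
    refine ContinuousOn.clm_apply ?_ (hb.continuousOn.comp hc.continuousOn hcl)
    intro t ht
    have h1 : ContinuousAt (fderiv ℝ ρ) (x + t • e) :=
      ((hball _ (hin t (hsub ht))).1.1.contDiffAt.fderiv_right (m := 1)
        (by norm_num)).continuousAt
    exact (ContinuousAt.comp (f := fun t : ℝ => x + t • e) h1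
      hc.continuousAt).continuousWithinAt
  have hF' : ∀ t : ℝ, ∃ F' : ℝ, t ∈ Ioo 0 T →
      HasDerivAt (fun t : ℝ => fderiv ℝ ρ (x + t • e) (b (x + t • e))) F' t ∧ |F'| ≤ L := by
    intro t
    by_cases ht : t ∈ Ioo 0 T
    · obtain ⟨F', hF', hF'L⟩ := (hball _ (hin t (hsub ⟨ht.1.le, ht.2.le⟩))).1.2
        (hltO t ⟨ht.1.le, ht.2⟩)
      have h := HasFDerivAt.comp_hasDerivAt (f := fun t : ℝ => x + t • e) t hF' (hline t)
      exact ⟨F' e, fun _ => ⟨h, hF'L⟩⟩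
    · exact ⟨0, fun h => absurd h ht⟩
  choose F' hF' using hF'
  have := abs_le_two_mul_abs_of_deriv_bound (L := L) hT0.le (hρcont.mono hsub) hFcont
    (fun t ht => hρline t (hsub ⟨ht.1.le, ht.2.le⟩)) (fun t ht => (hF' t ht).1)
    (fun t ht => (hball _ (hin t (hsub ⟨ht.1.le, ht.2.le⟩))).2.le)
    (fun t ht => (hF' t ht).2) hL hTz
    ((hball _ (hin T hT)).1.1.fderiv_apply_eq_zero (htan _ hTf))
  simpa using this

end TangentialBound

/-! ### Cutoffs with bounded derivative along the field. -/

section Cutoff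

variable {d : ℕ} {O : Set (Rd d)}

/-- The derivative vanishes unless `1 ≤ t ≤ 2`. With `t = n |ρ|`, the factor `t` absorbs the `n`
from the chain rule and the `|ρ|` from the tangential bound, uniformly in `n`. -/
theorem exists_abs_mul_deriv_smoothTransition_le :
    ∃ M, ∀ t : ℝ, |t * deriv Real.smoothTransition (t - 1)| ≤ M := by
  have hS : ContDiff ℝ 1 Real.smoothTransition := Real.smoothTransition.contDiff
  have hcont : Continuous fun t : ℝ => t * deriv Real.smoothTransition (t - 1) :=
    continuous_id.mul ((hS.continuous_deriv le_rfl).comp (continuous_id.sub continuous_const))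
  have hsupp : HasCompactSupport fun t : ℝ => t * deriv Real.smoothTransition (t - 1) := by
    refine HasCompactSupport.intro (isCompact_Icc (a := (1 : ℝ)) (b := 2)) fun t ht => ?_
    have hz : deriv Real.smoothTransition (t - 1) = 0 := by
      rw [mem_Icc, not_and_or, not_le, not_le] at ht
      rcases ht with ht | ht
      · have : Real.smoothTransition =ᶠ[𝓝 (t - 1)] fun _ => 0 := by
          filter_upwards [gt_mem_nhds (show t - 1 < 0 by linarith)] with s hs
          exact Real.smoothTransition.zero_of_nonpos hs.le
        rw [this.deriv_eq, deriv_const]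
      · have : Real.smoothTransition =ᶠ[𝓝 (t - 1)] fun _ => 1 := by
          filter_upwards [lt_mem_nhds (show 1 < t - 1 by linarith)] with s hs
          exact Real.smoothTransition.one_of_one_le hs.le
        rw [this.deriv_eq, deriv_const]
    rw [hz, mul_zero]
  exact hsupp.exists_bound_of_continuous hcont

/-- There are `C¹` cutoff functions vanishing near `s`, converging to `1` locally in `O`, with
derivatives along `b` bounded uniformly on `O`. -/
def HasTangentialCutoffs (O : Set (Rd d)) (b : Rd d → Rd d) (s : Set (Rd d)) : Prop :=
  ∃ (χ : ℕ → Rd d → ℝ) (C : ℝ), (∀ n, ContDiff ℝ 1 (χ n)) ∧ (∀ n x, χ n x ∈ Icc (0 : ℝ) 1) ∧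
    (∀ n, ∀ y ∈ s, ∀ᶠ z in 𝓝 y, χ n z = 0) ∧
    (∀ x ∈ O, ∀ᶠ n in atTop, ∀ᶠ y in 𝓝 x, χ n y = 1) ∧
    ∀ n, ∀ x ∈ O, |fderiv ℝ (χ n) x (b x)| ≤ C

theorem HasTangentialCutoffs.mono {b : Rd d → Rd d} {s t : Set (Rd d)} (hst : s ⊆ t)
    (h : HasTangentialCutoffs O b t) : HasTangentialCutoffs O b s := by
  obtain ⟨χ, C, h1, h2, h3, h4, h5⟩ := h
  exact ⟨χ, C, h1, h2, fun n y hy => h3 n y (hst hy), h4, h5⟩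

theorem hasTangentialCutoffs_empty (b : Rd d → Rd d) : HasTangentialCutoffs O b ∅ :=
  ⟨fun _ _ => 1, 0, fun _ => contDiff_const, fun _ _ => ⟨zero_le_one, le_rfl⟩,
    fun _ _ h => h.elim, fun _ _ => by simp, fun n x _ => by simp⟩

/-- Take products: since the factors lie in `[0, 1]`, the derivative bounds simply add. -/
theorem HasTangentialCutoffs.union {b : Rd d → Rd d} {s t : Set (Rd d)}
    (hs : HasTangentialCutoffs O b s) (ht : HasTangentialCutoffs O b t) :
    HasTangentialCutoffs O b (s ∪ t) := by
  obtain ⟨χ, C, h1, h2, h3, h4, h5⟩ := hs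
  obtain ⟨ψ, D, k1, k2, k3, k4, k5⟩ := ht
  refine ⟨fun n x => χ n x * ψ n x, C + D, fun n => (h1 n).mul (k1 n), fun n x =>
    ⟨mul_nonneg (h2 n x).1 (k2 n x).1, mul_le_one₀ (h2 n x).2 (k2 n x).1 (k2 n x).2⟩,
    ?_, ?_, ?_⟩
  · rintro n y (hy | hy)
    · filter_upwards [h3 n y hy] with z hz
      rw [hz, zero_mul]
    · filter_upwards [k3 n y hy] with z hz
      rw [hz, mul_zero]
  · intro x hx
    filter_upwards [h4 x hx, k4 x hx] with n hn kn
    filter_upwards [hn, kn] with y hy ky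
    rw [hy, ky, one_mul]
  · intro n x hx
    rw [fderiv_fun_mul ((h1 n).differentiable one_ne_zero x)
      ((k1 n).differentiable one_ne_zero x)]
    simp only [_root_.add_apply, _root_.smul_apply, smul_eq_mul]
    refine (abs_add_le _ _).trans ?_
    rw [abs_mul, abs_mul, abs_of_nonneg (h2 n x).1, abs_of_nonneg (k2 n x).1, add_comm]
    exact add_le_add ((mul_le_of_le_one_left (abs_nonneg _) (k2 n x).2).trans (h5 n x hx))
      ((mul_le_of_le_one_left (abs_nonneg _) (h2 n x).2).trans (k5 n x hx))

theorem hasTangentialCutoffs_local (hO : IsOpen O) {b : Rd d → Rd d} {B : ℝ}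
    (hB : ∀ x ∈ O, ‖b x‖ ≤ B) (hb : ContDiffOn ℝ 2 b (closure O))
    (htan : ∀ x ∈ frontier O, ∀ ν, IsOuterUnitNormal O x ν → ⟪b x, ν⟫_ℝ = 0)
    {x₀ : Rd d} (hx₀ : x₀ ∈ frontier O) {ρ : Rd d → ℝ}
    (hρ : IsLocalDefiningFunction O x₀ ρ) :
    ∃ s ∈ 𝓝[frontier O] x₀, HasTangentialCutoffs O b s := by
  obtain ⟨K, hK, hKe⟩ := exists_abs_fderiv_le hO hb htan hx₀ hρ
  obtain ⟨r, hr, hball⟩ := Metric.eventually_nhds_iff_ball.1 (hρ.eventually.and hKe)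
  obtain ⟨M, hM⟩ := exists_abs_mul_deriv_smoothTransition_le
  let θ : ContDiffBump x₀ := ⟨r / 4, r / 2, by positivity, by linarith⟩
  have hθr : tsupport θ ⊆ Metric.ball x₀ r := by
    rw [θ.tsupport_eq]
    exact Metric.closedBall_subset_ball (half_lt_self hr)
  have hθ : ContDiff ℝ 1 θ := θ.contDiff
  have hS : ContDiff ℝ 1 Real.smoothTransition := Real.smoothTransition.contDiff
  obtain ⟨A, hA⟩ := (θ.hasCompactSupport.fderiv (𝕜 := ℝ)).exists_bound_of_continuous
    (hθ.continuous_fderiv one_ne_zero)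
  have hA0 : 0 ≤ A := (norm_nonneg _).trans (hA x₀)
  -- Where `θ = 1` this is a transition in `-n ρ`, and off the support of `θ` it is `1`, so `ρ`
  -- matters only where it defines `O`. The shift by `1` makes it vanish in a neighbourhood of the
  -- boundary piece, not merely on it.
  let χ : ℕ → Rd d → ℝ := fun n x =>
    1 - θ x * (1 - Real.smoothTransition (-(n : ℝ) * ρ x - 1))
  have hout : ∀ n, ∀ x ∉ tsupport θ, χ n =ᶠ[𝓝 x] fun _ => 1 := by
    intro n x hx
    filter_upwards [notMem_tsupport_iff_eventuallyEq.1 hx] with y hy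
    simp [χ, hy]
  have hρc : ∀ x ∈ tsupport θ, ContDiffAt ℝ 1 ρ x := fun x hx =>
    (hball x (hθr hx)).1.contDiffAt.of_le (by norm_num)
  -- In the derivative bound, `K * M` controls the transition in `ρ` and `A * B` the gradient of
  -- `θ`.
  refine ⟨frontier O ∩ Metric.ball x₀ (r / 4),
    inter_mem self_mem_nhdsWithin (mem_nhdsWithin_of_mem_nhds
      (Metric.ball_mem_nhds x₀ (by positivity))), χ, K * M + A * B, ?_, ?_, ?_, ?_, ?_⟩
  · intro n
    rw [contDiff_iff_contDiffAt]
    intro x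
    by_cases hx : x ∈ tsupport θ
    · exact contDiffAt_const.sub (hθ.contDiffAt.mul (contDiffAt_const.sub
        (hS.contDiffAt.comp x ((contDiffAt_const.mul (hρc x hx)).sub contDiffAt_const))))
    · exact contDiffAt_const.congr_of_eventuallyEq (hout n x hx)
  · intro n x
    have s0 := Real.smoothTransition.nonneg (-(n : ℝ) * ρ x - 1)
    have s1 := Real.smoothTransition.le_one (-(n : ℝ) * ρ x - 1)
    have t0 : 0 ≤ θ x := θ.nonneg
    have t1 : θ x ≤ 1 := θ.le_one
    have h1 : θ x * (1 - Real.smoothTransition (-(n : ℝ) * ρ x - 1)) ≤ 1 :=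
      mul_le_one₀ t1 (by linarith) (by linarith)
    have h2 : 0 ≤ θ x * (1 - Real.smoothTransition (-(n : ℝ) * ρ x - 1)) :=
      mul_nonneg t0 (by linarith)
    constructor <;> simp only [χ] <;> linarith
  · rintro n y ⟨hyf, hyb⟩
    have hyr : y ∈ Metric.ball x₀ r := Metric.ball_subset_ball (by linarith) hyb
    have hdef := (hball y hyr).1
    have hρ0 : ρ y = 0 := hdef.eq_zero_of_mem_frontier hO hyf
    have hc : ContinuousAt (fun z => -(n : ℝ) * ρ z - 1) y :=
      (continuousAt_const.mul hdef.contDiffAt.continuousAt).sub continuousAt_const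
    filter_upwards [hc.eventually (gt_mem_nhds (by simp [hρ0] : _ < (0 : ℝ))),
      Metric.isOpen_ball.mem_nhds hyb] with z hz hzb
    have h1 : θ z = 1 := θ.one_of_mem_closedBall (Metric.ball_subset_closedBall hzb)
    simp only [χ, h1, Real.smoothTransition.zero_of_nonpos hz.le]
    norm_num
  · intro x hx
    by_cases hxt : x ∈ tsupport θ
    · have hdef := (hball x (hθr hxt)).1
      have hneg : ρ x < 0 := hdef.mem_iff.self_of_nhds.1 hx
      have hlim : Tendsto (fun n : ℕ => (n : ℝ) * -ρ x) atTop atTop :=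
        tendsto_natCast_atTop_atTop.atTop_mul_const (neg_pos.2 hneg)
      filter_upwards [hlim.eventually_gt_atTop 2] with n hn
      have hc : ContinuousAt (fun z => -(n : ℝ) * ρ z - 1) x :=
        (continuousAt_const.mul hdef.contDiffAt.continuousAt).sub continuousAt_const
      filter_upwards [hc.eventually (lt_mem_nhds (by linarith : (1 : ℝ) < _))] with z hz
      simp only [χ, Real.smoothTransition.one_of_one_le hz.le]
      norm_num
    · exact Eventually.of_forall fun n => hout n x hxt
  · intro n x hx
    have hB0 : 0 ≤ B := (norm_nonneg _).trans (hB x hx)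
    have hM0 : 0 ≤ M := (abs_nonneg _).trans (hM 0)
    by_cases hxt : x ∈ tsupport θ
    · have hdef := (hball x (hθr hxt)).1
      have hneg : ρ x < 0 := hdef.mem_iff.self_of_nhds.1 hx
      have hKx := (hball x (hθr hxt)).2 hx
      set a : ℝ := -(n : ℝ) * ρ x - 1 with ha
      have hρd : HasFDerivAt ρ (fderiv ℝ ρ x) x :=
        ((hρc x hxt).differentiableAt one_ne_zero).hasFDerivAt
      have hSd : HasDerivAt Real.smoothTransition (deriv Real.smoothTransition a) a :=
        (hS.differentiable one_ne_zero a).hasDerivAt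
      have hin : HasFDerivAt (fun z => -(n : ℝ) * ρ z - 1) (-(n : ℝ) • fderiv ℝ ρ x) x :=
        (hρd.const_mul _).sub_const 1
      have hcomp := hSd.comp_hasFDerivAt x hin
      have hχ := ((hθ.differentiable one_ne_zero x).hasFDerivAt.fun_mul
        (hcomp.const_sub 1)).const_sub 1
      have hval : fderiv ℝ (χ n) x (b x) =
          -(θ x * ((n : ℝ) * deriv Real.smoothTransition a * fderiv ℝ ρ x (b x))) -
          (1 - Real.smoothTransition a) * fderiv ℝ θ x (b x) := by
        have := congrArg (fun L : Rd d →L[ℝ] ℝ => L (b x)) hχ.fderiv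
        simp only [Function.comp_def] at this
        refine this.trans ?_
        simp only [_root_.neg_apply, _root_.add_apply,
          _root_.smul_apply, smul_eq_mul, ← ha]
        ring
      rw [hval]
      refine (abs_sub _ _).trans (add_le_add ?_ ?_)
      · rw [abs_neg, abs_mul, abs_of_nonneg θ.nonneg]
        refine (mul_le_of_le_one_left (abs_nonneg _) θ.le_one).trans ?_
        have e1 : |(n : ℝ) * -ρ x * deriv Real.smoothTransition ((n : ℝ) * -ρ x - 1)| ≤ M :=
          hM _
        have e2 : (n : ℝ) * -ρ x - 1 = a := by rw [ha]; ring
        rw [e2, abs_mul, abs_mul, abs_neg, abs_of_nonneg (Nat.cast_nonneg n)] at e1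
        rw [abs_mul, abs_mul, abs_of_nonneg (Nat.cast_nonneg n)]
        calc (n : ℝ) * |deriv Real.smoothTransition a| * |fderiv ℝ ρ x (b x)|
            ≤ (n : ℝ) * |deriv Real.smoothTransition a| * (K * |ρ x|) := by gcongr
          _ = K * ((n : ℝ) * |ρ x| * |deriv Real.smoothTransition a|) := by ring
          _ ≤ K * M := by gcongr
      · have s0 := Real.smoothTransition.nonneg a
        have s1 := Real.smoothTransition.le_one a
        rw [abs_mul, abs_of_nonneg (by linarith : 0 ≤ 1 - Real.smoothTransition a)]
        refine (mul_le_of_le_one_left (abs_nonneg _) (by linarith)).trans ?_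
        exact ((fderiv ℝ θ x).le_opNorm (b x)).trans
          (mul_le_mul (hA x) (hB x hx) (norm_nonneg _) hA0)
    · rw [(hout n x hxt).fderiv_eq]
      simp
      positivity

theorem hasTangentialCutoffs_frontier (hO : IsOpen O) (hbd : Bornology.IsBounded O)
    (hreg : HasC2Boundary O) {b : Rd d → Rd d} (hb : ContDiffOn ℝ 2 b (closure O))
    (htan : ∀ x ∈ frontier O, ∀ ν, IsOuterUnitNormal O x ν → ⟪b x, ν⟫_ℝ = 0) :
    HasTangentialCutoffs O b (frontier O) := by
  have hcl := hbd.isCompact_closure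
  obtain ⟨B, hB⟩ := hcl.exists_bound_of_continuousOn hb.continuousOn
  have hfr : IsCompact (frontier O) :=
    hcl.of_isClosed_subset isClosed_frontier frontier_subset_closure
  -- Compactness of the boundary patches the local cutoffs together by finitely many products.
  refine hfr.induction_on (hasTangentialCutoffs_empty b) (fun s t hst h => h.mono hst)
    (fun s t hs ht => hs.union ht) fun x hx => ?_
  obtain ⟨ρ, hρ⟩ := hreg x hx
  exact hasTangentialCutoffs_local hO (fun x hx => hB x (subset_closure hx)) hb htan hx hρ

/-- Truncating to `O` a function which vanishes near the boundary. -/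
theorem contDiff_indicator_of_eventually_zero (hO : IsOpen O) (hbd : Bornology.IsBounded O)
    {χ : Rd d → ℝ} (hχ : ContDiff ℝ 1 χ) (hz : ∀ y ∈ frontier O, ∀ᶠ z in 𝓝 y, χ z = 0) :
    ContDiff ℝ 1 (O.indicator χ) ∧ HasCompactSupport (O.indicator χ) ∧
      tsupport (O.indicator χ) ⊆ O := by
  have hout : ∀ x ∉ O, O.indicator χ =ᶠ[𝓝 x] fun _ => 0 := by
    intro x hx
    by_cases hxc : x ∈ closure O
    · filter_upwards [hz x (by rw [hO.frontier_eq]; exact ⟨hxc, hx⟩)] with y hy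
      simp [indicator, hy]
    · filter_upwards [isClosed_closure.isOpen_compl.mem_nhds hxc] with y hy
      exact indicator_of_notMem (fun h => hy (subset_closure h)) χ
  have hs : tsupport (O.indicator χ) ⊆ O := by
    intro x hx
    by_contra hxO
    exact notMem_tsupport_iff_eventuallyEq.2 (hout x hxO) hx
  refine ⟨?_, ?_, hs⟩
  · rw [contDiff_iff_contDiffAt]
    intro x
    by_cases hx : x ∈ O
    · refine hχ.contDiffAt.congr_of_eventuallyEq ?_
      filter_upwards [hO.mem_nhds hx] with y hy
      exact indicator_of_mem hy χ
    · exact contDiffAt_const.congr_of_eventuallyEq (hout x hx)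
  · exact hbd.isCompact_closure.of_isClosed_subset (isClosed_tsupport _)
      (hs.trans subset_closure)

end Cutoff

/-! ### Skew-symmetry, density and the adjoint. -/

section SkewSymmetry

variable {d : ℕ} {O : Set (Rd d)}

/-- A divergence-free tangential field acts as a skew-symmetric operator on `H¹`. -/
theorem IsWeakGradient.integral_field_skew (hO : IsOpen O) (hbd : Bornology.IsBounded O)
    (hreg : HasC2Boundary O) {b : Rd d → Rd d} (hb : ContDiffOn ℝ 2 b (closure O))
    (htan : ∀ x ∈ frontier O, ∀ ν, IsOuterUnitNormal O x ν → ⟪b x, ν⟫_ℝ = 0)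
    (hdiv : ∀ x ∈ closure O, divergence O b x = 0) {u v : L2 O} {g h : L2Vec O}
    (hu : IsWeakGradient O u g) (hv : IsWeakGradient O v h) :
    ∫ x in O, (u x * ⟪b x, h x⟫_ℝ + v x * ⟪b x, g x⟫_ℝ) = 0 := by
  obtain ⟨χ, C, h1, h2, h3, h4, h5⟩ := hasTangentialCutoffs_frontier hO hbd hreg hb htan
  have hdiv' : ∀ x ∈ O, ∑ k : Fin d, fderiv ℝ b x (EuclideanSpace.single k 1) k = 0 := by
    intro x hx
    rw [← hdiv x (subset_closure hx), divergence, jacobian,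
      fderivWithin_of_mem_nhds (mem_of_superset (hO.mem_nhds hx) subset_closure)]
  have hbO : ContDiffOn ℝ 1 b O := (hb.of_le (by norm_num)).mono subset_closure
  have hm := hO.measurableSet
  have iuv : Integrable (fun x => u x * v x) (volume.restrict O) :=
    MemLp.integrable_mul (p := 2) (q := 2) (Lp.memLp u) (Lp.memLp v)
  have iB : Integrable (fun x => u x * ⟪b x, h x⟫_ℝ + v x * ⟪b x, g x⟫_ℝ)
      (volume.restrict O) :=
    (MemLp.integrable_mul (p := 2) (q := 2) (Lp.memLp u)
      (memLp_inner_field hO hbd hb.continuousOn h)).add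
    (MemLp.integrable_mul (p := 2) (q := 2) (Lp.memLp v)
      (memLp_inner_field hO hbd hb.continuousOn g))
  have hzero : ∀ n, ∫ x in O, (χ n x * (u x * ⟪b x, h x⟫_ℝ + v x * ⟪b x, g x⟫_ℝ) +
      u x * v x * fderiv ℝ (χ n) x (b x)) = 0 := by
    intro n
    -- The cutoff need not vanish outside the closure of `O`; truncation gives compact support in
    -- `O` without changing it on `O`.
    obtain ⟨c1, c2, c3⟩ := contDiff_indicator_of_eventually_zero hO hbd (h1 n) (h3 n)
    rw [← hu.integral_cutoff_field hO hv hbO hdiv' c1 c2 c3]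
    refine setIntegral_congr_fun hm fun x hx => ?_
    have : O.indicator (χ n) =ᶠ[𝓝 x] χ n := by
      filter_upwards [hO.mem_nhds hx] with y hy
      exact indicator_of_mem hy _
    simp only [this.fderiv_eq, indicator_of_mem hx]
  have hlim : Tendsto (fun n => ∫ x in O,
      (χ n x * (u x * ⟪b x, h x⟫_ℝ + v x * ⟪b x, g x⟫_ℝ) +
      u x * v x * fderiv ℝ (χ n) x (b x))) atTop
      (𝓝 (∫ x in O, (u x * ⟪b x, h x⟫_ℝ + v x * ⟪b x, g x⟫_ℝ))) := by
    -- The uniform tangential bound `C` supplies the majorant. At each point of `O` the cutoffs are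
    -- eventually locally `1`, so their derivative term vanishes.
    refine tendsto_integral_of_dominated_convergence
      (fun x => ‖u x * ⟪b x, h x⟫_ℝ + v x * ⟪b x, g x⟫_ℝ‖ + ‖u x * v x‖ * C) ?_
      (iB.norm.add (iuv.norm.mul_const C)) ?_ ?_
    · intro n
      have hD : AEStronglyMeasurable (fun x => fderiv ℝ (χ n) x (b x)) (volume.restrict O) :=
        (((h1 n).continuous_fderiv one_ne_zero).continuousOn.clm_apply
          hbO.continuousOn).aestronglyMeasurable hm
      exact ((h1 n).continuous.aestronglyMeasurable.mul iB.1).add (iuv.1.mul hD)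
    · intro n
      filter_upwards [ae_restrict_mem hm] with x hx
      refine (norm_add_le _ _).trans (add_le_add ?_ ?_)
      · rw [norm_mul, Real.norm_of_nonneg (h2 n x).1]
        exact mul_le_of_le_one_left (norm_nonneg _) (h2 n x).2
      · rw [norm_mul]
        exact mul_le_mul_of_nonneg_left (h5 n x hx) (norm_nonneg _)
    · filter_upwards [ae_restrict_mem hm] with x hx
      refine tendsto_const_nhds.congr' ?_
      filter_upwards [h4 x hx] with n hn
      have hn' : χ n =ᶠ[𝓝 x] fun _ => 1 := hn
      rw [hn'.fderiv_eq, hn'.self_of_nhds]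
      simp
  simp_rw [hzero] at hlim
  exact tendsto_nhds_unique hlim tendsto_const_nhds

theorem mem_H1_of_contDiff {φ : Rd d → ℝ} (hφ : ContDiff ℝ ∞ φ) (hc : HasCompactSupport φ)
    (hφm : MemLp φ 2 (volume.restrict O)) (hs : tsupport φ ⊆ O) : hφm.toLp φ ∈ H1 O := by
  have hφ' : Continuous (gradient φ) :=
    (InnerProductSpace.toDual ℝ (Rd d)).symm.continuous.comp (hφ.continuous_fderiv (by simp))
  have hgrad : ∀ (x : Rd d) (j : Fin d),
      gradient φ x j = fderiv ℝ φ x (EuclideanSpace.single j 1) := by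
    intro x j
    have h : ⟪gradient φ x, EuclideanSpace.single j (1 : ℝ)⟫_ℝ = gradient φ x j := by
      rw [EuclideanSpace.inner_single_right]
      simp
    rw [← h, gradient, InnerProductSpace.toDual_symm_apply]
  have hc' : HasCompactSupport (gradient φ) :=
    (hc.fderiv (𝕜 := ℝ)).comp_left (g := (InnerProductSpace.toDual ℝ (Rd d)).symm) (map_zero _)
  have hm : MemLp (gradient φ) 2 (volume.restrict O) :=
    hφ'.memLp_of_hasCompactSupport hc'
  refine ⟨hm.toLp _, fun ψ hψ hcψ hsψ j => ?_⟩
  have e1 : ∫ x in O, hφm.toLp φ x * fderiv ℝ ψ x (EuclideanSpace.single j 1) =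
      ∫ x in O, φ x * fderiv ℝ ψ x (EuclideanSpace.single j 1) := by
    refine integral_congr_ae ?_
    filter_upwards [hφm.coeFn_toLp] with x hx
    rw [hx]
  have e2 : ∫ x in O, hm.toLp (gradient φ) x j * ψ x =
      ∫ x in O, fderiv ℝ φ x (EuclideanSpace.single j 1) * ψ x := by
    refine integral_congr_ae ?_
    filter_upwards [hm.coeFn_toLp] with x hx
    rw [hx, hgrad]
  have hφd : Continuous fun x => fderiv ℝ φ x (EuclideanSpace.single j 1) :=
    (hφ.continuous_fderiv (by simp)).clm_apply continuous_const
  have hψd : Continuous fun x => fderiv ℝ ψ x (EuclideanSpace.single j 1) :=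
    (hψ.continuous_fderiv (by simp)).clm_apply continuous_const
  have hφ0 : ∀ x ∉ O, φ x = 0 := fun x hx => image_eq_zero_of_notMem_tsupport (mt (@hs x) hx)
  have hψ0 : ∀ x ∉ O, ψ x = 0 := fun x hx => image_eq_zero_of_notMem_tsupport (mt (@hsψ x) hx)
  rw [e1, e2, setIntegral_eq_integral_of_forall_compl_eq_zero fun x hx => by
    rw [hφ0 x hx, zero_mul], setIntegral_eq_integral_of_forall_compl_eq_zero fun x hx => by
    rw [hψ0 x hx, mul_zero]]
  exact integral_mul_fderiv_eq_neg_fderiv_mul_of_integrable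
    ((hφd.mul hψ.continuous).integrable_of_hasCompactSupport hcψ.mul_left)
    ((hφ.continuous.mul hψd).integrable_of_hasCompactSupport hc.mul_right)
    ((hφ.continuous.mul hψ.continuous).integrable_of_hasCompactSupport hc.mul_right)
    (fun x _ => hφ.differentiable (by simp) x) (fun x _ => hψ.differentiable (by simp) x)

/-- A function orthogonal to `H1 O` is orthogonal to all test functions, hence zero by the
fundamental lemma of the calculus of variations. -/
theorem dense_H1 (hO : IsOpen O) : Dense (H1 O : Set (L2 O)) := by
  rw [Submodule.dense_iff_topologicalClosure_eq_top, Submodule.topologicalClosure_eq_top_iff,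
    Submodule.eq_bot_iff]
  intro f hf
  have hloc : LocallyIntegrableOn f O volume :=
    locallyIntegrableOn_of_locallyIntegrable_restrict
      ((Lp.memLp f).locallyIntegrable (by norm_num))
  have hz := hO.ae_eq_zero_of_integral_contDiff_smul_eq_zero hloc fun φ hφ hc hs => by
    have hφm : MemLp φ 2 (volume.restrict O) :=
      hφ.continuous.memLp_of_hasCompactSupport hc
    have h := hf _ (mem_H1_of_contDiff hφ hc hφm hs)
    rw [L2.inner_def] at h
    rw [← setIntegral_eq_integral_of_forall_compl_eq_zero (s := O), ← h]
    · refine integral_congr_ae ?_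
      filter_upwards [hφm.coeFn_toLp] with x hx
      rw [hx]
      simp [mul_comm]
    · intro x hx
      rw [image_eq_zero_of_notMem_tsupport (fun hx' => hx (hs hx')), zero_smul]
  refine (Lp.eq_zero_iff_ae_eq_zero).2 ?_
  exact (ae_restrict_iff' hO.measurableSet).2 hz

theorem inner_fieldOperator_eq_neg (hO : IsOpen O) (hbd : Bornology.IsBounded O)
    (hreg : HasC2Boundary O) {b : Rd d → Rd d} (hb : ContDiffOn ℝ 2 b (closure O))
    (htan : ∀ x ∈ frontier O, ∀ ν, IsOuterUnitNormal O x ν → ⟪b x, ν⟫_ℝ = 0)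
    (hdiv : ∀ x ∈ closure O, divergence O b x = 0) (u v : H1 O) :
    ⟪(u : L2 O), fieldOperator hO hbd hb.continuousOn v⟫_ℝ =
      -⟪fieldOperator hO hbd hb.continuousOn u, (v : L2 O)⟫_ℝ := by
  have key := (isWeakGradient_weakGradient u).integral_field_skew hO hbd hreg hb htan hdiv
    (isWeakGradient_weakGradient v)
  have i1 : Integrable (fun x => (u : L2 O) x * ⟪b x, weakGradient v x⟫_ℝ)
      (volume.restrict O) :=
    MemLp.integrable_mul (p := 2) (q := 2) (Lp.memLp (u : L2 O))
      (memLp_inner_field hO hbd hb.continuousOn (weakGradient v))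
  have i2 : Integrable (fun x => (v : L2 O) x * ⟪b x, weakGradient u x⟫_ℝ)
      (volume.restrict O) :=
    MemLp.integrable_mul (p := 2) (q := 2) (Lp.memLp (v : L2 O))
      (memLp_inner_field hO hbd hb.continuousOn (weakGradient u))
  rw [integral_add i1 i2] at key
  rw [L2.inner_def, L2.inner_def, eq_neg_iff_add_eq_zero, ← key]
  congr 1
  · refine integral_congr_ae ?_
    filter_upwards [fieldOperator_coeFn hO hbd hb.continuousOn v] with x hx
    rw [hx]
    simp [mul_comm]
  · refine integral_congr_ae ?_
    filter_upwards [fieldOperator_coeFn hO hbd hb.continuousOn u] with x hx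
    rw [hx]
    simp

end SkewSymmetry

theorem lemma2p3 {d N : ℕ} (hd : 1 ≤ d) (O : Set (Rd d)) (hO : IsOpen O)
    (hbd : Bornology.IsBounded O) (hreg : HasC2Boundary O)
    (b : Fin N → Rd d → Rd d) (hb : CoefficientAssumption O b) (i : Fin N) :
    let B : L2 O →ₗ.[ℝ] L2 O := fieldOperator hO hbd (hb.contDiffOn i).continuousOn
    Dense (B.domain : Set (L2 O)) ∧
    (∀ u : H1 O, ∃ hu : (u : L2 O) ∈ B.adjoint.domain, B u = -B.adjoint ⟨(u : L2 O), hu⟩) ∧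
    (∀ u : H1 O, Integrable (fun ξ => (u : L2 O) ξ * B u ξ) (volume.restrict O) ∧
      ∫ ξ in O, (u : L2 O) ξ * B u ξ = 0) := by
  intro B
  have hdense : Dense (B.domain : Set (L2 O)) := dense_H1 hO
  have hskew : ∀ u v : H1 O, ⟪(u : L2 O), B v⟫_ℝ = -⟪B u, (v : L2 O)⟫_ℝ := fun u v =>
    inner_fieldOperator_eq_neg hO hbd hreg (hb.contDiffOn i) (hb.tangential i)
      (hb.div_eq_zero i) u v
  -- Thus `-B u` represents the functional `x ↦ ⟪u, B x⟫`, which puts `u` in the adjoint domain;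
  -- density of the domain makes the representative unique.
  have hadj : ∀ u : H1 O, ∀ x : B.domain, ⟪-B u, (x : L2 O)⟫_ℝ = ⟪(u : L2 O), B x⟫_ℝ := by
    intro u x
    rw [inner_neg_left]
    exact (hskew u x).symm
  refine ⟨hdense, fun u => ?_, fun u => ⟨?_, ?_⟩⟩
  · have hu : (u : L2 O) ∈ B.adjoint.domain :=
      LinearPMap.mem_adjoint_domain_of_exists (T := B) _ ⟨-B u, hadj u⟩
    refine ⟨hu, ?_⟩
    rw [LinearPMap.adjoint_apply_eq hdense ⟨(u : L2 O), hu⟩ (hadj u), neg_neg]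
  · exact MemLp.integrable_mul (p := 2) (q := 2) (Lp.memLp (u : L2 O)) (Lp.memLp (B u))
  · have h := hskew u u
    rw [real_inner_comm, eq_neg_iff_add_eq_zero, ← two_mul, mul_eq_zero] at h
    have h' := h.resolve_left two_ne_zero
    rw [L2.inner_def] at h'
    rw [← h']
    refine integral_congr_ae (Eventually.of_forall fun x => ?_)
    simp
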